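/- Let $W=(W(t))_{0\le t\le 1}$ be a standard Brownian motion, let $Y$ be a Bernoulli$(1/2)$ random variable independent of $W$, let $f,g\in\mathbb L^2([0,1])$, and let $X=(X(t))_{0\le t\le 1}$ be the continuous process with $X(0)=0$ and $$dX(t)=Y f(t)\,dt+(1-Y)g(t)\,dt+dW(t),\qquad t\in[0,1].$$ The risk of a classifier $\Phi$ (a measurable map from continuous trajectories to $\{0,1\}$) is $\mathcal R_{f,g}(\Phi)=\mathbb P(\Phi(X)\ne Y)$. Let $\eta(X)=\mathbb P(Y=1\mid X)$ be the regression function and $\Phi^\star(X)=\mathbf 1_{\{\eta(X)\ge 1/2\}}$ the Bayes classifier. Let $(\varphi_j)_{j\ge1}$ be any orthonormal (Hilbert) basis of $\mathbb L^2([0,1])$, let $d\ge 1$ be an integer, and write $h_d=\Pi_d(h)=\sum_{j=1}^d\langle\varphi_j,h\rangle\varphi_j$ for $h\in\mathbb L^2([0,1])$. Define $$L_d(X)=\int_0^1 (f_d-g_d)(s)\,dX_s-\tfrac12\|f_d\|^2+\tfrac12\|g_d\|^2,\qquad \eta_d(X)=\frac{e^{L_d(X)}}{1+e^{L_d(X)}},\qquad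 \Phi_d^\star(X)=\mathbf 1_{\{\eta_d(X)\ge 1/2\}},$$ where $\int_0^1\varphi(s)\,dX_s$ is the stochastic (Wiener) integral. Set $\Delta=\|f-g\|$. Suppose that $0<\epsilon\le 1/8$ and $$\max\left(\|f-f_d\|^2,\|g-g_d\|^2\right)\le\frac{\epsilon^2}{512\ln(1/\epsilon^2)}.$$ Then $$\mathcal R_{f,g}(\Phi_d^\star)-\mathcal R_{f,g}(\Phi^\star)\le 12\epsilon^2+2\epsilon\left(1\wedge\frac{10\epsilon}{\Delta}\right),$$ where $1\wedge\frac{10\epsilon}{\Delta}=1$ if $\Delta=0$. -/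

import Mathlib

open MeasureTheory ProbabilityTheory Filter Topology Set
open scoped InnerProductSpace

noncomputable section

namespace WhiteNoise

/-- The space of continuous trajectories on `[0,1]`. -/
abbrev Path : Type := C(unitInterval, ℝ)

/-- The σ-algebra on continuous trajectories generated by the coordinates `x ↦ x t`
(it is also the Borel σ-algebra of the uniform norm). -/
instance instMeasurableSpacePath : MeasurableSpace Path :=
  MeasurableSpace.comap (fun (x : Path) (t : unitInterval) => x t) MeasurableSpace.pi

/-- The Hilbert space `L²([0,1])` for the Lebesgue measure. -/
abbrev L2I : Type := Lp ℝ 2 (volume : Measure unitInterval)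

/-- `W` is a standard Brownian motion `(W t)_{0 ≤ t ≤ 1}` with continuous paths. -/
structure IsBrownianMotion {Ω : Type*} [MeasurableSpace Ω] (P : Measure Ω)
    (W : Ω → Path) : Prop where
  measurable : Measurable W
  zero : ∀ᵐ ω ∂P, W ω 0 = 0
  indep_increments : HasIndepIncrements (fun (t : unitInterval) ω => W ω t) P
  law_increment : ∀ s t : unitInterval, s ≤ t →
    HasLaw (fun ω => W ω t - W ω s) (gaussianReal 0 (Real.toNNReal ((t : ℝ) - s))) P

/-- The label `0` or `1` as a real number. -/
def label (y : Fin 2) : ℝ := ((y : ℕ) : ℝ)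

/-- The model `dX(t) = Y f(t) dt + (1 - Y) g(t) dt + dW(t)`, `0 ≤ t ≤ 1`, `X(0) = 0`, where `W` is
a standard Brownian motion and `Y` is a Bernoulli(1/2) label independent of `W`. -/
structure IsModel {Ω : Type*} [MeasurableSpace Ω] (P : Measure Ω) (f g : L2I)
    (W X : Ω → Path) (Y : Ω → Fin 2) : Prop where
  brownian : IsBrownianMotion P W
  measurable_label : Measurable Y
  bernoulli : P {ω | Y ω = 1} = 1 / 2
  indep : IndepFun W Y P
  measurable_path : Measurable X
  equation : ∀ᵐ ω ∂P, ∀ t : unitInterval,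
    X ω t = label (Y ω) * (∫ s in Iic t, f s) + (1 - label (Y ω)) * (∫ s in Iic t, g s) + W ω t

/-- A finite linear combination `∑ i, coeff i • 𝟙_{(left i, right i]}` of indicators of
subintervals of `[0,1]`. -/
structure StepFun where
  n : ℕ
  left : Fin n → unitInterval
  right : Fin n → unitInterval
  left_le_right : ∀ i, left i ≤ right i
  coeff : Fin n → ℝ

/-- The function on `[0,1]` that a step function stands for. -/
def StepFun.eval (s : StepFun) (t : unitInterval) : ℝ :=
  ∑ i, (Ioc (s.left i) (s.right i)).indicator (fun _ => s.coeff i) t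

/-- The elementary integral of a step function against a trajectory,
`∑ i, coeff i * (x (right i) - x (left i))`. -/
def StepFun.integral (s : StepFun) (x : Path) : ℝ :=
  ∑ i, s.coeff i * (x (s.right i) - x (s.left i))

/-- `J` is a version of the stochastic integral `x ↦ ∫₀¹ φ(t) dx(t)` for trajectories of law `μ`:
a measurable functional of the trajectory, which is the limit in `μ`-probability of the elementary
integrals of every sequence of step functions that converges to `φ` in `L²([0,1])`. -/
def IsStochIntegral (μ : Measure Path) (φ : L2I) (J : Path → ℝ) : Prop :=
  Measurable J ∧
    ∀ s : ℕ → StepFun,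
      Tendsto (fun k => eLpNorm (fun t => (s k).eval t - φ t) 2 volume) atTop (𝓝 0) →
        TendstoInMeasure μ (fun k x => (s k).integral x) atTop J

open Classical in
/-- The stochastic integral `x ↦ ∫₀¹ φ(t) dx(t)` for trajectories of law `μ`; it is unique up to
`μ`-null sets. -/
def stochIntegral (μ : Measure Path) (φ : L2I) : Path → ℝ :=
  if h : ∃ J : Path → ℝ, IsStochIntegral μ φ J then h.choose else 0

/-- The projection `Π_d(h) = ∑_{j=1}^d ⟨φ_j, h⟩ φ_j`; the basis is indexed from `0` here, so that
its first `d` elements are `φ 0, …, φ (d - 1)`. -/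
def proj (φ : HilbertBasis ℕ ℝ L2I) (d : ℕ) (h : L2I) : L2I :=
  ∑ j ∈ Finset.range d, ⟪φ j, h⟫_ℝ • φ j

section Classification

variable {Ω : Type*} [MeasurableSpace Ω] (P : Measure Ω) [IsProbabilityMeasure P]
  (X : Ω → Path) (Y : Ω → Fin 2)

/-- The regression function `η(x) = ℙ(Y = 1 | X = x)`. -/
def eta (x : Path) : ℝ := (condDistrib Y X P x).real {1}

open Classical in
/-- The Bayes classifier `Φ⋆ = 𝟙{η ≥ 1/2}`. -/
def bayes (x : Path) : Fin 2 := if 1 / 2 ≤ eta P X Y x then 1 else 0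

/-- The risk `ℙ(Φ(X) ≠ Y)` of a classifier `Φ`. -/
def risk (Φ : Path → Fin 2) : ℝ := P.real {ω | Φ (X ω) ≠ Y ω}

/-- `∫₀¹ (f - g)(s) dX_s - ‖f‖² / 2 + ‖g‖² / 2` as a functional of the trajectory `X`. -/
def logRatio (f g : L2I) (x : Path) : ℝ :=
  stochIntegral (P.map X) (f - g) x - 1 / 2 * ‖f‖ ^ 2 + 1 / 2 * ‖g‖ ^ 2

/-- The truncated regression function `η_d`, in which `f` and `g` are replaced by
`Π_d(f)` and `Π_d(g)`. -/
def etaTrunc (φ : HilbertBasis ℕ ℝ L2I) (d : ℕ) (f g : L2I) (x : Path) : ℝ :=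
  Real.exp (logRatio P X (proj φ d f) (proj φ d g) x) /
    (1 + Real.exp (logRatio P X (proj φ d f) (proj φ d g) x))

open Classical in
/-- The truncated oracle classifier `Φ_d⋆ = 𝟙{η_d ≥ 1/2}`. -/
def bayesTrunc (φ : HilbertBasis ℕ ℝ L2I) (d : ℕ) (f g : L2I) (x : Path) : Fin 2 :=
  if 1 / 2 ≤ etaTrunc P X φ d f g x then 1 else 0

end Classification

/-- `1 ∧ (10 ε / Δ)`, with value `1` for `Δ = 0`. -/
def marginBound (ε Δ : ℝ) : ℝ := if Δ = 0 then 1 else min 1 (10 * ε / Δ)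

end WhiteNoise

end

noncomputable section

namespace WhiteNoise

/-! ### Measurability on the path space -/

/-! Write Ψ for the standard normal distribution function (`normalCDF`), Δ = ‖f - g‖ and D = ‖f_d -
g_d‖. Given Y, the statistic L_d is Gaussian with variance D² and mean D²/2 or -D²/2, because
pairing f_d - g_d with f or g only sees f_d or g_d. Hence the truncated classifier has risk exactly
Ψ(-D/2) (`risk_bayesTrunc`). Every measurable classifier, the Bayes one included, has risk at least
Ψ(-Δ/2) (`normalCDF_le_risk`). The normal density is at most 1/2, so the excess risk is at most (Δ -
D)/4. By Pythagoras Δ² - D² is the squared norm of the tail of f - g, which is at most ε²; hence Δ -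
D is at most ε, and at most ε²/Δ when Δ > 0. Neither a formula for η nor the optimality of the Bayes
rule is needed.

The lower bound avoids Girsanov's theorem. For h = (f - g)/Δ, a Wiener trajectory splits into its
Gaussian coordinate along h and an independent residual (`indepFun_integral_residual`). Once the
residual is fixed, the two hypotheses differ only by a shift Δ of a standard normal variable, and
the one-dimensional Neyman–Pearson bound is integrated over the residual
(`two_mul_gaussianReal_le`).

The Wiener integral is the isometric extension of 𝟙_[0,t] ↦ x(t); `stochIntegral_ae_eq` identifies
the integral against X with drift terms plus this integral along W. -/

lemma measurable_path_iff {α : Type*} [MeasurableSpace α] {F : α → Path} :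
    Measurable F ↔ ∀ t, Measurable fun a => F a t := by
  rw [measurable_comap_iff, measurable_pi_iff]
  rfl

@[fun_prop]
lemma measurable_path_eval (t : unitInterval) : Measurable fun x : Path => x t :=
  measurable_path_iff.1 measurable_id t

/-! ### Wiener measure -/

/-- `ν` is a centred Gaussian law on the path space with the covariance of Brownian motion. -/
structure IsWiener (ν : Measure Path) : Prop where
  gaussian : IsGaussianProcess (fun (t : unitInterval) (x : Path) => x t) ν
  mean : ∀ t : unitInterval, ∫ x, x t ∂ν = 0
  cov : ∀ s t : unitInterval, ∫ x, x s * x t ∂ν = ((min s t : unitInterval) : ℝ)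

lemma integral_sq_gaussianReal_zero (v : NNReal) : ∫ x, x ^ 2 ∂(gaussianReal 0 v) = v := by
  have h := variance_fun_id_gaussianReal (μ := 0) (v := v)
  rwa [variance_of_integral_eq_zero (by fun_prop) integral_id_gaussianReal] at h

section BrownianMotion

variable {Ω : Type*} [MeasurableSpace Ω] {P : Measure Ω} {W : Ω → Path}

lemma IsBrownianMotion.hasLaw_eval (hW : IsBrownianMotion P W) (t : unitInterval) :
    HasLaw (fun ω => W ω t) (gaussianReal 0 (Real.toNNReal t)) P := by
  refine HasLaw.congr (X := fun ω => W ω t - W ω 0) ?_ ?_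
  · simpa using hW.law_increment 0 t t.2.1
  · filter_upwards [hW.zero] with ω h
    simp [h]

lemma IsBrownianMotion.isGaussianProcess (hW : IsBrownianMotion P W) :
    IsGaussianProcess (fun (t : unitInterval) ω => W ω t) P :=
  hW.indep_increments.isGaussianProcess (fun t => (hW.hasLaw_eval t).hasGaussianLaw) hW.zero

lemma IsBrownianMotion.integral_mul (hW : IsBrownianMotion P W) (s t : unitInterval) :
    ∫ ω, W ω s * W ω t ∂P = ((min s t : unitInterval) : ℝ) := by
  wlog hst : s ≤ t generalizing s t
  · rw [min_comm, ← this t s (le_of_not_ge hst)]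
    simp_rw [mul_comm]
  have m : ∀ r, MemLp (fun ω => W ω r) 2 P := fun r =>
    (hW.hasLaw_eval r).hasGaussianLaw.memLp_two
  have sq : ∀ {Z : Ω → ℝ} {v : NNReal}, HasLaw Z (gaussianReal 0 v) P →
      ∫ ω, Z ω ^ 2 ∂P = v := fun {Z v} h => by
    rw [← integral_sq_gaussianReal_zero v, ← h.map_eq, integral_map h.aemeasurable (by fun_prop)]
  have e1 := sq (hW.hasLaw_eval s)
  have e2 := sq (hW.hasLaw_eval t)
  have e3 := sq (hW.law_increment s t hst)
  -- Polarisation reduces the covariance to the variances of W s, W t and the increment.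
  have e4 : ∫ ω, W ω s * W ω t ∂P =
      ∫ ω, (1 / 2 : ℝ) * (W ω s ^ 2 + W ω t ^ 2 - (W ω t - W ω s) ^ 2) ∂P := by
    congr 1; ext ω; ring
  rw [e4, integral_const_mul, integral_sub, integral_add, e1, e2, e3, min_eq_left hst,
    Real.coe_toNNReal _ s.2.1, Real.coe_toNNReal _ t.2.1, Real.coe_toNNReal _ (sub_nonneg.2 hst)]
  · ring
  · exact (m s).integrable_sq
  · exact (m t).integrable_sq
  · exact (m s).integrable_sq.add (m t).integrable_sq
  · exact ((m t).sub (m s)).integrable_sq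

lemma IsBrownianMotion.isWiener (hW : IsBrownianMotion P W) : IsWiener (P.map W) where
  gaussian := ⟨fun I => by
    refine ⟨?_⟩
    have h := (hW.isGaussianProcess.hasGaussianLaw I).isGaussian_map
    have hm : Measurable fun x : Path => I.restrict fun t => x t :=
      measurable_pi_lambda _ fun i => measurable_path_eval _
    rw [Measure.map_map hm hW.measurable]
    exact h⟩
  mean t := by
    rw [integral_map hW.measurable.aemeasurable
      (measurable_path_eval t).aestronglyMeasurable]
    have h := (hW.hasLaw_eval t).integral_eq
    rw [h]
    exact integral_id_gaussianReal
  cov s t := by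
    rw [integral_map hW.measurable.aemeasurable (by fun_prop)]
    exact hW.integral_mul s t

end BrownianMotion

/-! ### Indicators of initial intervals in `L²([0,1])` -/

/-- The indicator function of `[0,t]` in `L²([0,1])`. -/
def initialInd (t : unitInterval) : L2I :=
  indicatorConstLp 2 (measurableSet_Iic (a := t)) (measure_ne_top _ _) (1 : ℝ)

lemma inner_initialInd_left (t : unitInterval) (φ : L2I) :
    ⟪initialInd t, φ⟫_ℝ = ∫ s in Iic t, φ s :=
  L2.inner_indicatorConstLp_one _ _ _

lemma inner_initialInd_initialInd (s t : unitInterval) :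
    ⟪initialInd s, initialInd t⟫_ℝ = ((min s t : unitInterval) : ℝ) := by
  rw [initialInd, initialInd, L2.real_inner_indicatorConstLp_one_indicatorConstLp_one,
    Iic_inter_Iic, measureReal_def, unitInterval.volume_Iic,
    ENNReal.toReal_ofReal (min s t).2.1]

/-- The initial intervals form a π-system generating the Borel sets, so a π-λ argument applies;
complements are handled because the case t = ⊤ makes the total integral vanish. -/
lemma eq_zero_of_forall_setIntegral_Iic_eq_zero {φ : L2I}
    (h : ∀ t : unitInterval, ∫ s in Iic t, φ s = 0) : φ = 0 := by
  have hi : Integrable φ volume := (Lp.memLp φ).integrable (by norm_num)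
  rw [Lp.eq_zero_iff_ae_eq_zero]
  refine hi.ae_eq_zero_of_forall_setIntegral_eq_zero fun s hs _ => ?_
  have huniv : ∫ s, φ s = 0 := by
    have := h ⊤
    rwa [Iic_top, setIntegral_univ] at this
  induction s, hs using MeasurableSpace.induction_on_inter
    (borel_eq_generateFrom_Iic unitInterval ▸ BorelSpace.measurable_eq (α := unitInterval))
    isPiSystem_Iic with
  | empty => simp
  | basic t ht =>
    obtain ⟨t, rfl⟩ := ht
    exact h t
  | compl t ht ih =>
    rw [setIntegral_compl ht hi, huniv, ih (measure_lt_top _ _), sub_zero]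
  | iUnion f hd hf ih =>
    rw [integral_iUnion hf hd hi.integrableOn]
    simp [fun i => ih i (measure_lt_top _ _)]

/-- The finite linear combinations of indicators of initial intervals. -/
def initialComb : (unitInterval →₀ ℝ) →ₗ[ℝ] L2I := Finsupp.linearCombination ℝ initialInd

lemma denseRange_initialComb : DenseRange initialComb := by
  have h : (LinearMap.range initialComb).topologicalClosure = ⊤ := by
    rw [Submodule.topologicalClosure_eq_top_iff, Submodule.eq_bot_iff]
    intro φ hφ
    refine eq_zero_of_forall_setIntegral_Iic_eq_zero fun t => ?_
    rw [← inner_initialInd_left]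
    exact hφ _ ⟨Finsupp.single t 1, by simp [initialComb]⟩
  have h2 := Submodule.dense_iff_topologicalClosure_eq_top.2 h
  exact h2

/-! ### The Wiener integral -/

namespace IsWiener

variable {ν : Measure Path} (hν : IsWiener ν)

include hν

lemma isProbabilityMeasure : IsProbabilityMeasure ν := hν.gaussian.isProbabilityMeasure

lemma memLp_eval (t : unitInterval) : MemLp (fun x : Path => x t) 2 ν :=
  (hν.gaussian.hasGaussianLaw_eval t).memLp_two

/-- The coordinate `x ↦ x t` as an element of `L²(ν)`. -/
def evalLp (t : unitInterval) : Lp ℝ 2 ν := (hν.memLp_eval t).toLp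

/-- The finite linear combinations of coordinates. -/
def evalComb : (unitInterval →₀ ℝ) →ₗ[ℝ] Lp ℝ 2 ν := Finsupp.linearCombination ℝ hν.evalLp

lemma inner_evalLp_evalLp (s t : unitInterval) :
    ⟪hν.evalLp s, hν.evalLp t⟫_ℝ = ((min s t : unitInterval) : ℝ) := by
  rw [L2.inner_def, ← hν.cov s t]
  refine integral_congr_ae ?_
  filter_upwards [(hν.memLp_eval s).coeFn_toLp, (hν.memLp_eval t).coeFn_toLp] with x hs ht
  simp only [evalLp, hs, ht, RCLike.inner_apply, conj_trivial]
  ring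

/-- The Itô isometry on finite combinations: indicators and coordinates have the same Gram matrix
`min s t`. This is what lets the integral extend by density. -/
lemma norm_evalComb (c : unitInterval →₀ ℝ) : ‖hν.evalComb c‖ = ‖initialComb c‖ := by
  rw [← sq_eq_sq₀ (norm_nonneg _) (norm_nonneg _), ← real_inner_self_eq_norm_sq,
    ← real_inner_self_eq_norm_sq]
  simp only [evalComb, initialComb, Finsupp.linearCombination_apply, Finsupp.sum, sum_inner,
    inner_sum, inner_smul_left, inner_smul_right, inner_evalLp_evalLp,
    inner_initialInd_initialInd]

lemma evalComb_ae_eq (c : unitInterval →₀ ℝ) :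
    hν.evalComb c =ᵐ[ν] fun x => ∑ t ∈ c.support, c t * x t := by
  rw [evalComb, Finsupp.linearCombination_apply, Finsupp.sum]
  refine (Lp.coeFn_finsetSum _ _).trans ?_
  have h : ∀ᵐ x ∂ν, ∀ t ∈ c.support, (c t • hν.evalLp t : Lp ℝ 2 ν) x = c t * x t := by
    rw [Finset.eventually_all]
    intro t _
    filter_upwards [Lp.coeFn_smul (c t) (hν.evalLp t), (hν.memLp_eval t).coeFn_toLp] with x h1 h2
    rw [h1, Pi.smul_apply, evalLp, h2, smul_eq_mul]
  filter_upwards [h] with x hx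
  rw [Finset.sum_apply]
  exact Finset.sum_congr rfl hx

/-- The Wiener integral `φ ↦ ∫₀¹ φ(t) dx(t)` with respect to the Wiener measure `ν`. -/
def integral : L2I →L[ℝ] Lp ℝ 2 ν := hν.evalComb.extendOfNorm initialComb

lemma integral_initialComb (c : unitInterval →₀ ℝ) :
    hν.integral (initialComb c) = hν.evalComb c :=
  LinearMap.extendOfNorm_eq denseRange_initialComb
    ⟨1, fun c => by rw [one_mul, hν.norm_evalComb]⟩ c

lemma integral_initialInd (t : unitInterval) : hν.integral (initialInd t) = hν.evalLp t := by
  simpa [initialComb, evalComb] using hν.integral_initialComb (Finsupp.single t 1)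

lemma integral_initialInd_ae_eq (t : unitInterval) :
    hν.integral (initialInd t) =ᵐ[ν] fun x => x t := by
  rw [integral_initialInd]
  exact (hν.memLp_eval t).coeFn_toLp

lemma norm_integral (φ : L2I) : ‖hν.integral φ‖ = ‖φ‖ := by
  refine denseRange_initialComb.induction_on φ
    (isClosed_eq (by fun_prop) continuous_norm) fun c => ?_
  rw [integral_initialComb, norm_evalComb]

lemma inner_integral (φ ψ : L2I) : ⟪hν.integral φ, hν.integral ψ⟫_ℝ = ⟪φ, ψ⟫_ℝ :=
  LinearIsometry.inner_map_map
    ⟨(hν.integral : L2I →ₗ[ℝ] Lp ℝ 2 ν), hν.norm_integral⟩ φ ψ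

lemma hasLaw_evalComb (c : unitInterval →₀ ℝ) :
    HasLaw (hν.evalComb c) (gaussianReal 0 (Real.toNNReal (‖initialComb c‖ ^ 2))) ν := by
  have := hν.isProbabilityMeasure
  have h0 : HasGaussianLaw (fun x : Path => ∑ t ∈ c.support, c t * x t) ν :=
    (hν.gaussian.smul c).hasGaussianLaw_fun_sum (I := c.support)
  have h1 : HasGaussianLaw (hν.evalComb c) ν := h0.congr (hν.evalComb_ae_eq c).symm
  have hm : ∫ x, hν.evalComb c x ∂ν = 0 := by
    rw [integral_congr_ae (hν.evalComb_ae_eq c), integral_finsetSum]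
    · simp [integral_const_mul, hν.mean]
    · exact fun t _ => ((hν.memLp_eval t).integrable (by norm_num)).const_mul _
  have hv : Var[hν.evalComb c; ν] = ‖initialComb c‖ ^ 2 := by
    rw [variance_of_integral_eq_zero (Lp.aestronglyMeasurable _).aemeasurable hm,
      ← hν.norm_evalComb, ← real_inner_self_eq_norm_sq, L2.inner_def]
    simp [sq]
  refine ⟨h1.aemeasurable, ?_⟩
  rw [h1.map_eq_gaussianReal, hm, hv]

/-- Characteristic functions pass to the limit along an almost surely convergent subsequence of
approximating combinations, whose Gaussian laws are known; the variances converge with the norms. -/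
lemma hasLaw_integral (φ : L2I) :
    HasLaw (hν.integral φ) (gaussianReal 0 (Real.toNNReal (‖φ‖ ^ 2))) ν := by
  have := hν.isProbabilityMeasure
  have hme : ∀ ζ : Lp ℝ 2 ν, AEMeasurable ζ ν := fun ζ => (Lp.aestronglyMeasurable ζ).aemeasurable
  refine ⟨hme _, Measure.ext_of_charFun ?_⟩
  have := Measure.isProbabilityMeasure_map (hme (hν.integral φ))
  ext u
  obtain ⟨y, hy, hlim⟩ := mem_closure_iff_seq_limit.1 (denseRange_initialComb φ)
  choose c hc using hy
  have hI : Tendsto (fun k => hν.integral (y k)) atTop (𝓝 (hν.integral φ)) :=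
    (hν.integral.continuous.tendsto φ).comp hlim
  obtain ⟨ns, hns, hae⟩ := (tendstoInMeasure_of_tendsto_Lp hI).exists_seq_tendsto_ae
  have hchar : ∀ ζ : Lp ℝ 2 ν, charFun (ν.map ζ) u =
      ∫ x, Complex.exp (u * ζ x * Complex.I) ∂ν := fun ζ => by
    rw [charFun_apply_real, integral_map (hme ζ) (by fun_prop)]
  have l1 : Tendsto (fun k => charFun (ν.map (hν.integral (y (ns k)))) u) atTop
      (𝓝 (charFun (ν.map (hν.integral φ)) u)) := by
    simp_rw [hchar]
    refine tendsto_integral_of_dominated_convergence (fun _ => 1) (fun k => ?_)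
      (integrable_const _) (fun k => ?_) ?_
    · have : Continuous fun r : ℝ => Complex.exp (u * r * Complex.I) := by fun_prop
      exact this.comp_aestronglyMeasurable (Lp.aestronglyMeasurable _)
    · refine .of_forall fun x => ?_
      rw [← Complex.ofReal_mul, Complex.norm_exp_ofReal_mul_I]
    · filter_upwards [hae] with x hx
      have : Continuous fun r : ℝ => Complex.exp (u * r * Complex.I) := by fun_prop
      exact (this.tendsto _).comp hx
  have l2 : Tendsto (fun k => charFun (ν.map (hν.integral (y (ns k)))) u) atTop
      (𝓝 (charFun (gaussianReal 0 (Real.toNNReal (‖φ‖ ^ 2))) u)) := by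
    have e : ∀ k, charFun (ν.map (hν.integral (y (ns k)))) u =
        charFun (gaussianReal 0 (Real.toNNReal (‖y (ns k)‖ ^ 2))) u := fun k => by
      rw [← hc, integral_initialComb, (hν.hasLaw_evalComb _).map_eq]
    simp_rw [e, charFun_gaussianReal, Real.coe_toNNReal _ (sq_nonneg _)]
    have : Continuous fun ψ : L2I => Complex.exp (u * (0 : ℝ) * Complex.I -
        ((‖ψ‖ ^ 2 : ℝ) : ℂ) * u ^ 2 / 2) := by fun_prop
    exact (this.tendsto φ).comp (hlim.comp hns.tendsto_atTop)
  exact tendsto_nhds_unique l1 l2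

/-- By linearity, each linear functional of finitely many integrals is again the integral of a
single element of L², hence Gaussian. -/
lemma isGaussianProcess_integral :
    IsGaussianProcess (fun (φ : L2I) (x : Path) => hν.integral φ x) ν := by
  refine ⟨fun I => ⟨isGaussian_of_map_eq_gaussianReal fun L => ?_⟩⟩
  have hme : ∀ ζ : Lp ℝ 2 ν, AEMeasurable ζ ν := fun ζ => (Lp.aestronglyMeasurable ζ).aemeasurable
  have hme' : AEMeasurable (fun x => I.restrict fun φ => hν.integral φ x) ν :=
    aemeasurable_pi_lambda _ fun i => hme _
  classical
  have hs : (hν.integral (∑ i : I, L (Pi.single i 1) • (i : L2I)) : Path → ℝ) =ᵐ[ν]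
      L ∘ fun x => I.restrict fun φ => hν.integral φ x := by
    rw [map_sum]
    refine (Lp.coeFn_finsetSum _ _).trans ?_
    have h : ∀ᵐ x ∂ν, ∀ i : I, hν.integral (L (Pi.single i 1) • (i : L2I)) x =
        L (Pi.single i 1) * hν.integral i x := by
      rw [eventually_all]
      intro i
      rw [map_smul]
      filter_upwards [Lp.coeFn_smul (L (Pi.single i 1)) (hν.integral i)] with x hx
      rw [hx, Pi.smul_apply, smul_eq_mul]
    filter_upwards [h] with x hx
    rw [Finset.sum_apply, Function.comp_apply, ← L.sum_comp_single]
    refine Finset.sum_congr rfl fun i _ => ?_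
    rw [hx i, ContinuousLinearMap.comp_apply, ContinuousLinearMap.single_apply, mul_comm,
      ← smul_eq_mul, ← map_smul, ← Pi.single_smul, smul_eq_mul, mul_one]
    rfl
  refine ⟨0, Real.toNNReal (‖∑ i : I, L (Pi.single i 1) • (i : L2I)‖ ^ 2), ?_⟩
  rw [AEMeasurable.map_map_of_aemeasurable (by fun_prop) hme', ← Measure.map_congr hs,
    (hν.hasLaw_integral _).map_eq]

end IsWiener

/-! ### Step functions -/

namespace StepFun

/-- A step function as an element of `L²([0,1])`. -/
def toLp (s : StepFun) : L2I :=
  ∑ i, s.coeff i • (initialInd (s.right i) - initialInd (s.left i))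

lemma coeFn_toLp (s : StepFun) : s.toLp =ᵐ[volume] s.eval := by
  refine (Lp.coeFn_finsetSum _ _).trans ?_
  have h : ∀ᵐ t, ∀ i, (s.coeff i • (initialInd (s.right i) - initialInd (s.left i)) : L2I) t =
      (Ioc (s.left i) (s.right i)).indicator (fun _ => s.coeff i) t := by
    rw [eventually_all]
    intro i
    filter_upwards [Lp.coeFn_smul (s.coeff i) (initialInd (s.right i) - initialInd (s.left i)),
      Lp.coeFn_sub (initialInd (s.right i)) (initialInd (s.left i)),
      indicatorConstLp_coeFn (p := 2) (hs := measurableSet_Iic (a := s.right i))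
        (hμs := measure_ne_top volume _) (c := (1 : ℝ)),
      indicatorConstLp_coeFn (p := 2) (hs := measurableSet_Iic (a := s.left i))
        (hμs := measure_ne_top volume _) (c := (1 : ℝ))] with t h1 h2 h3 h4
    rw [h1, Pi.smul_apply, h2, Pi.sub_apply, initialInd, initialInd, h3, h4]
    have := s.left_le_right i
    by_cases hl : t ≤ s.left i
    · simp [hl, hl.trans this, indicator]
    · by_cases hr : t ≤ s.right i <;> simp [hl, hr, indicator, not_le.1 hl]
  filter_upwards [h] with t ht
  rw [Finset.sum_apply]
  exact Finset.sum_congr rfl fun i _ => ht i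

lemma tendsto_toLp_iff {s : ℕ → StepFun} {φ : L2I} :
    Tendsto (fun k => (s k).toLp) atTop (𝓝 φ) ↔
      Tendsto (fun k => eLpNorm (fun t => (s k).eval t - φ t) 2 volume) atTop (𝓝 0) := by
  rw [Lp.tendsto_Lp_iff_tendsto_eLpNorm']
  refine tendsto_congr fun k => eLpNorm_congr_ae ?_
  filter_upwards [(s k).coeFn_toLp] with t ht
  rw [Pi.sub_apply, ht]

lemma exists_toLp_eq_initialComb (c : unitInterval →₀ ℝ) : ∃ s : StepFun, s.toLp = initialComb c := by
  have h0 : initialInd 0 = 0 := by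
    rw [← norm_eq_zero, ← sq_eq_zero_iff, ← real_inner_self_eq_norm_sq,
      inner_initialInd_initialInd]
    simp
  let e := c.support.equivFin.symm
  -- Left endpoints at 0 cost nothing, since {0} is Lebesgue-null and `initialInd 0 = 0`.
  refine ⟨⟨_, fun _ => 0, fun i => e i, fun i => (e i).1.2.1, fun i => c (e i)⟩, ?_⟩
  simp only [toLp, h0, sub_zero, initialComb, Finsupp.linearCombination_apply, Finsupp.sum]
  rw [Equiv.sum_comp e fun t : c.support => c t • initialInd t]
  exact Finset.sum_coe_sort c.support fun t => c t • initialInd t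

lemma exists_tendsto_toLp (φ : L2I) :
    ∃ s : ℕ → StepFun, Tendsto (fun k => (s k).toLp) atTop (𝓝 φ) := by
  obtain ⟨y, hy, hlim⟩ := mem_closure_iff_seq_limit.1 (denseRange_initialComb φ)
  choose c hc using hy
  choose s hs using fun k => exists_toLp_eq_initialComb (c k)
  refine ⟨s, ?_⟩
  simp_rw [hs, hc]
  exact hlim

@[fun_prop]
lemma measurable_integral (s : StepFun) : Measurable s.integral :=
  Finset.measurable_fun_sum _ fun _ _ =>
    ((measurable_path_eval _).sub (measurable_path_eval _)).const_mul _

end StepFun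

lemma IsWiener.integral_toLp_ae_eq {ν : Measure Path} (hν : IsWiener ν) (s : StepFun) :
    hν.integral s.toLp =ᵐ[ν] s.integral := by
  rw [StepFun.toLp, map_sum]
  refine (Lp.coeFn_finsetSum _ _).trans ?_
  have h : ∀ᵐ x ∂ν, ∀ i, hν.integral
      (s.coeff i • (initialInd (s.right i) - initialInd (s.left i))) x =
      s.coeff i * (x (s.right i) - x (s.left i)) := by
    rw [eventually_all]
    intro i
    rw [map_smul, map_sub]
    filter_upwards [Lp.coeFn_smul (s.coeff i)
        (hν.integral (initialInd (s.right i)) - hν.integral (initialInd (s.left i))),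
      Lp.coeFn_sub (hν.integral (initialInd (s.right i))) (hν.integral (initialInd (s.left i))),
      hν.integral_initialInd_ae_eq (s.right i), hν.integral_initialInd_ae_eq (s.left i)]
      with x h1 h2 h3 h4
    rw [h1, Pi.smul_apply, h2, Pi.sub_apply, h3, h4, smul_eq_mul]
  filter_upwards [h] with x hx
  rw [Finset.sum_apply]
  exact Finset.sum_congr rfl fun i _ => hx i

/-! ### The stochastic integral in the model -/

lemma tendstoInMeasure_map_iff {Ω E : Type*} [MeasurableSpace Ω] [MeasurableSpace E]
    {P : Measure Ω} {X : Ω → E} (hX : Measurable X) {F : ℕ → E → ℝ} {J : E → ℝ}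
    (hF : ∀ k, Measurable (F k)) (hJ : Measurable J) :
    TendstoInMeasure (P.map X) F atTop J ↔
      TendstoInMeasure P (fun k ω => F k (X ω)) atTop fun ω => J (X ω) := by
  unfold TendstoInMeasure
  refine forall₂_congr fun ε _ => tendsto_congr fun k => ?_
  exact Measure.map_apply hX (measurableSet_le measurable_const ((hF k).edist hJ))

namespace IsModel

variable {Ω : Type*} [MeasurableSpace Ω] {P : Measure Ω}
  {f g : L2I} {W X : Ω → Path} {Y : Ω → Fin 2}

lemma isWiener (hX : IsModel P f g W X Y) : IsWiener (P.map W) := hX.brownian.isWiener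

variable [IsProbabilityMeasure P]

lemma memLp_label (hX : IsModel P f g W X Y) : MemLp (fun ω => label (Y ω)) 2 P :=
  MemLp.of_bound ((measurable_from_top (f := label)).comp hX.measurable_label).aestronglyMeasurable
    1 (.of_forall fun ω => by
      simp only [label, Real.norm_natCast]
      exact_mod_cast Nat.lt_succ_iff.1 (Y ω).2)

/-- The value `Y ⟪φ, f⟫ + (1 - Y) ⟪φ, g⟫ + ∫₀¹ φ dW` of `∫₀¹ φ dX`, in `L²(P)`. -/
def integralLp (hX : IsModel P f g W X Y) (φ : L2I) : Lp ℝ 2 P :=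
  ⟪φ, f⟫_ℝ • hX.memLp_label.toLp + ⟪φ, g⟫_ℝ • ((memLp_const 1).sub hX.memLp_label).toLp +
    Lp.compMeasurePreservingₗᵢ ℝ W (hX.brownian.measurable.measurePreserving P)
      (hX.isWiener.integral φ)

lemma continuous_integralLp (hX : IsModel P f g W X Y) : Continuous hX.integralLp := by
  unfold integralLp
  fun_prop

lemma integralLp_ae_eq (hX : IsModel P f g W X Y) (φ : L2I) :
    hX.integralLp φ =ᵐ[P] fun ω => label (Y ω) * ⟪φ, f⟫_ℝ + (1 - label (Y ω)) * ⟪φ, g⟫_ℝ +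
      hX.isWiener.integral φ (W ω) := by
  unfold integralLp
  set A := hX.memLp_label.toLp
  set B := ((memLp_const 1).sub hX.memLp_label).toLp
  have hW := hX.brownian.measurable.measurePreserving P
  filter_upwards [Lp.coeFn_add (⟪φ, f⟫_ℝ • A + ⟪φ, g⟫_ℝ • B)
      (Lp.compMeasurePreservingₗᵢ ℝ W hW (hX.isWiener.integral φ)),
    Lp.coeFn_add (⟪φ, f⟫_ℝ • A) (⟪φ, g⟫_ℝ • B), Lp.coeFn_smul ⟪φ, f⟫_ℝ A,
    Lp.coeFn_smul ⟪φ, g⟫_ℝ B, hX.memLp_label.coeFn_toLp,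
    ((memLp_const 1).sub hX.memLp_label).coeFn_toLp,
    Lp.coeFn_compMeasurePreserving (hX.isWiener.integral φ) hW] with ω h1 h2 h3 h4 h5 h6 h7
  rw [h1, Pi.add_apply, h2, Pi.add_apply, h3, h4, Pi.smul_apply, Pi.smul_apply, h5, h6]
  change _ + Lp.compMeasurePreserving W hW (hX.isWiener.integral φ) ω = _
  rw [h7]
  simp [mul_comm]

lemma integral_path_ae_eq (hX : IsModel P f g W X Y) (s : StepFun) :
    (fun ω => s.integral (X ω)) =ᵐ[P] hX.integralLp s.toLp := by
  have hinner : ∀ h : L2I, ⟪s.toLp, h⟫_ℝ =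
      ∑ i, s.coeff i * ((∫ t in Iic (s.right i), h t) - ∫ t in Iic (s.left i), h t) := fun h => by
    simp only [StepFun.toLp, sum_inner, inner_smul_left, inner_sub_left, inner_initialInd_left,
      conj_trivial]
  filter_upwards [hX.equation, hX.integralLp_ae_eq s.toLp,
    ae_of_ae_map hX.brownian.measurable.aemeasurable (hX.isWiener.integral_toLp_ae_eq s)]
    with ω h1 h2 h3
  rw [h2, h3, hinner, hinner]
  simp only [StepFun.integral, h1, Finset.mul_sum, ← Finset.sum_add_distrib]
  exact Finset.sum_congr rfl fun i _ => by ring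

lemma tendstoInMeasure_integral (hX : IsModel P f g W X Y) {s : ℕ → StepFun} {φ : L2I}
    (hs : Tendsto (fun k => (s k).toLp) atTop (𝓝 φ)) :
    TendstoInMeasure P (fun k ω => (s k).integral (X ω)) atTop (hX.integralLp φ) :=
  (tendstoInMeasure_of_tendsto_Lp ((hX.continuous_integralLp.tendsto φ).comp hs)).congr_left
    fun k => (hX.integral_path_ae_eq (s k)).symm

/-- The L² limit lives on Ω, whereas a functional of the trajectory is required. It is obtained as
the almost sure limit, under the law of X, of elementary integrals along a subsequence; any other
approximating sequence has the same limit `integralLp`. -/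
lemma exists_isStochIntegral (hX : IsModel P f g W X Y) (φ : L2I) :
    ∃ J, IsStochIntegral (P.map X) φ J := by
  have := Measure.isProbabilityMeasure_map (μ := P) hX.measurable_path.aemeasurable
  obtain ⟨s, hs⟩ := StepFun.exists_tendsto_toLp φ
  obtain ⟨ns, hns, hae⟩ := (hX.tendstoInMeasure_integral hs).exists_seq_tendsto_ae
  have hconv : ∀ᵐ x ∂(P.map X), ∃ l, Tendsto (fun k => (s (ns k)).integral x) atTop (𝓝 l) := by
    rw [ae_map_iff hX.measurable_path.aemeasurable
      (measurableSet_exists_tendsto fun k => (s (ns k)).measurable_integral)]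
    filter_upwards [hae] with ω hω using ⟨_, hω⟩
  obtain ⟨J, hJ, hJlim⟩ := measurable_limit_of_tendsto_metrizable_ae
    (fun k => (s (ns k)).measurable_integral.aemeasurable) hconv
  have hJX : hX.integralLp φ =ᵐ[P] fun ω => J (X ω) := by
    filter_upwards [hae, ae_of_ae_map hX.measurable_path.aemeasurable hJlim] with ω h1 h2
    exact tendsto_nhds_unique h1 h2
  refine ⟨J, hJ, fun s' hs' => ?_⟩
  rw [tendstoInMeasure_map_iff hX.measurable_path (fun k => (s' k).measurable_integral) hJ]
  exact (hX.tendstoInMeasure_integral (StepFun.tendsto_toLp_iff.2 hs')).congr_right hJX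

lemma isStochIntegral_stochIntegral (hX : IsModel P f g W X Y) (φ : L2I) :
    IsStochIntegral (P.map X) φ (stochIntegral (P.map X) φ) := by
  rw [stochIntegral, dif_pos (hX.exists_isStochIntegral φ)]
  exact (hX.exists_isStochIntegral φ).choose_spec

lemma stochIntegral_ae_eq (hX : IsModel P f g W X Y) (φ : L2I) :
    (fun ω => stochIntegral (P.map X) φ (X ω)) =ᵐ[P] fun ω =>
      label (Y ω) * ⟪φ, f⟫_ℝ + (1 - label (Y ω)) * ⟪φ, g⟫_ℝ +
        hX.isWiener.integral φ (W ω) := by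
  refine EventuallyEq.trans ?_ (hX.integralLp_ae_eq φ)
  obtain ⟨s, hs⟩ := StepFun.exists_tendsto_toLp φ
  have hJ := hX.isStochIntegral_stochIntegral φ
  exact tendstoInMeasure_ae_unique
    ((tendstoInMeasure_map_iff hX.measurable_path (fun k => (s k).measurable_integral) hJ.1).1
      (hJ.2 s (StepFun.tendsto_toLp_iff.1 hs)))
    (hX.tendstoInMeasure_integral hs)

end IsModel

/-! ### One-dimensional Gaussian estimates -/

/-- The distribution function of the standard normal law. -/
def normalCDF (r : ℝ) : ℝ := (gaussianReal 0 1).real (Iic r)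

lemma gaussianReal_Ici (a : ℝ) : gaussianReal 0 1 (Ici a) = gaussianReal 0 1 (Iic (-a)) := by
  have h := gaussianReal_map_neg (μ := 0) (v := 1)
  rw [neg_zero] at h
  conv_lhs => rw [← h]
  rw [Measure.map_apply measurable_neg measurableSet_Ici]
  congr 1
  ext z
  simp

lemma gaussianReal_Iic_half (m : ℝ) :
    gaussianReal m 1 (Iic (m / 2)) = gaussianReal 0 1 (Iic (-(m / 2))) := by
  have h := gaussianReal_map_add_const (μ := 0) (v := 1) m
  rw [zero_add] at h
  rw [← h, Measure.map_apply (measurable_add_const m) measurableSet_Iic]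
  congr 1
  ext z
  simp only [mem_preimage, mem_Iic]
  constructor <;> intro h <;> linarith

lemma gaussianPDF_le_of_sq_le {m m' x : ℝ} (h : (x - m') ^ 2 ≤ (x - m) ^ 2) :
    gaussianPDF m 1 x ≤ gaussianPDF m' 1 x := by
  refine ENNReal.ofReal_le_ofReal ?_
  simp only [gaussianPDFReal]
  gcongr

lemma gaussianReal_le_of_forall_sq_le {m m' : ℝ} {S : Set ℝ}
    (h : ∀ x ∈ S, (x - m') ^ 2 ≤ (x - m) ^ 2) : gaussianReal m 1 S ≤ gaussianReal m' 1 S := by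
  rw [gaussianReal_apply _ one_ne_zero, gaussianReal_apply _ one_ne_zero]
  exact setLIntegral_mono (measurable_gaussianPDF _ _) fun x hx => gaussianPDF_le_of_sq_le (h x hx)

/-- The Neyman–Pearson bound for the two hypotheses `N(m, 1)` and `N(0, 1)`. -/
lemma two_mul_gaussianReal_Iic_le {m : ℝ} (hm : 0 ≤ m) {A : Set ℝ} (hA : MeasurableSet A) :
    2 * gaussianReal 0 1 (Iic (-(m / 2))) ≤ gaussianReal m 1 A + gaussianReal 0 1 Aᶜ := by
  set B : Set ℝ := Iic (m / 2)
  have hB : MeasurableSet B := measurableSet_Iic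
  have hIci : gaussianReal 0 1 Bᶜ = gaussianReal 0 1 (Iic (-(m / 2))) := by
    have := nullSingletonClass_gaussianReal (μ := 0) (one_ne_zero (α := NNReal))
    rw [← gaussianReal_Ici, compl_Iic, measure_congr Ioi_ae_eq_Ici]
  -- Equality holds for the likelihood-ratio set B = {x ≤ m/2}; replacing B by A can only increase
  -- the sum, as comparing densities on B \ A and A \ B shows.
  have e : 2 * gaussianReal 0 1 (Iic (-(m / 2))) = gaussianReal m 1 B + gaussianReal 0 1 Bᶜ := by
    rw [hIci, gaussianReal_Iic_half, two_mul]
  have i1 : gaussianReal m 1 (B \ A) ≤ gaussianReal 0 1 (B \ A) :=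
    gaussianReal_le_of_forall_sq_le fun x hx => by
      have : x ≤ m / 2 := hx.1
      nlinarith
  have i2 : gaussianReal 0 1 (A \ B) ≤ gaussianReal m 1 (A \ B) :=
    gaussianReal_le_of_forall_sq_le fun x hx => by
      have : m / 2 < x := not_le.1 hx.2
      nlinarith
  rw [e, ← measure_inter_add_sdiff B hA, ← measure_inter_add_sdiff A hB,
    ← measure_inter_add_sdiff Aᶜ hB, ← measure_inter_add_sdiff Bᶜ hA]
  have e1 : Bᶜ ∩ A = A \ B := by ext; simp [and_comm]
  have e2 : Aᶜ ∩ B = B \ A := by ext; simp [and_comm]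
  have e3 : Aᶜ \ B = Bᶜ \ A := by ext; simp [and_comm]
  rw [e1, e2, e3, inter_comm B A]
  calc _ ≤ gaussianReal m 1 (A ∩ B) + gaussianReal 0 1 (B \ A) +
        (gaussianReal m 1 (A \ B) + gaussianReal 0 1 (Bᶜ \ A)) := by gcongr
    _ = _ := by ring

lemma gaussianReal_Iic_zero : 2 * gaussianReal 0 1 (Iic 0) = 1 := by
  have := nullSingletonClass_gaussianReal (μ := 0) (one_ne_zero (α := NNReal))
  have h : gaussianReal 0 1 (Iic 0) = gaussianReal 0 1 (Iic 0)ᶜ := by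
    rw [compl_Iic, measure_congr Ioi_ae_eq_Ici, gaussianReal_Ici, neg_zero]
  rw [two_mul]
  nth_rewrite 2 [h]
  rw [measure_add_measure_compl measurableSet_Iic, measure_univ]

/-- The error probabilities of the likelihood ratio test between `N(-D²/2, D²)` and
`N(D²/2, D²)`. -/
lemma gaussianReal_sq_Iio_add_Ici {D : ℝ} (hD : 0 ≤ D) :
    gaussianReal 0 (Real.toNNReal (D ^ 2)) (Iio (-(D ^ 2 / 2))) +
      gaussianReal 0 (Real.toNNReal (D ^ 2)) (Ici (D ^ 2 / 2)) =
      2 * gaussianReal 0 1 (Iic (-(D / 2))) := by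
  -- For D = 0 the law is a point mass at 0: the open half-line gets 0 and the closed one gets 1.
  rcases hD.eq_or_lt with rfl | hD
  · simp [gaussianReal_Iic_zero]
  have := nullSingletonClass_gaussianReal (μ := 0) (one_ne_zero (α := NNReal))
  have h := gaussianReal_map_const_mul (μ := 0) (v := 1) D
  have hv : NNReal.mk (D ^ 2) (sq_nonneg D) * 1 = Real.toNNReal (D ^ 2) := by
    ext; simp [sq_nonneg]
  rw [mul_zero, hv] at h
  have s1 : (D * ·) ⁻¹' Iio (-(D ^ 2 / 2)) = Iio (-(D / 2)) := by
    ext z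
    simp only [mem_preimage, mem_Iio]
    constructor <;> intro h <;> nlinarith
  have s2 : (D * ·) ⁻¹' Ici (D ^ 2 / 2) = Ici (D / 2) := by
    ext z
    simp only [mem_preimage, mem_Ici]
    constructor <;> intro h <;> nlinarith
  rw [← h, Measure.map_apply (measurable_const_mul D) measurableSet_Iio,
    Measure.map_apply (measurable_const_mul D) measurableSet_Ici, s1, s2, gaussianReal_Ici,
    measure_congr Iio_ae_eq_Iic, two_mul]

/-- The density is at most 1/√(2π) ≤ 1/2. -/
lemma normalCDF_sub_le {a b : ℝ} (hab : a ≤ b) : normalCDF b - normalCDF a ≤ (b - a) / 2 := by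
  have hd : normalCDF b - normalCDF a = (gaussianReal 0 1).real (Ioc a b) := by
    rw [normalCDF, normalCDF, ← measureReal_sdiff (Iic_subset_Iic.2 hab) measurableSet_Iic,
      Iic_sdiff_Iic]
  have hp : ∀ x, gaussianPDF 0 1 x ≤ ENNReal.ofReal (1 / 2) := fun x => by
    refine ENNReal.ofReal_le_ofReal ?_
    rw [gaussianPDFReal]
    have h1 : (√(2 * Real.pi * (1 : NNReal)))⁻¹ ≤ 1 / 2 := by
      rw [one_div]
      refine inv_anti₀ two_pos (Real.le_sqrt_of_sq_le ?_)
      rw [NNReal.coe_one]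
      linarith [Real.pi_gt_three]
    have h2 : Real.exp (-(x - 0) ^ 2 / (2 * (1 : NNReal))) ≤ 1 := by
      rw [Real.exp_le_one_iff, NNReal.coe_one]
      nlinarith [sq_nonneg x]
    calc _ ≤ 1 / 2 * (1 : ℝ) := by gcongr
      _ = 1 / 2 := mul_one _
  rw [hd, measureReal_def]
  refine ENNReal.toReal_le_of_le_ofReal (by linarith) ?_
  rw [gaussianReal_apply _ one_ne_zero]
  calc _ ≤ ∫⁻ _ in Ioc a b, ENNReal.ofReal (1 / 2) := lintegral_mono hp
    _ = ENNReal.ofReal ((b - a) / 2) := by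
      rw [setLIntegral_const, Real.volume_Ioc, ← ENNReal.ofReal_mul (by norm_num)]
      congr 1; ring

/-! ### The projection `Π_d` -/

section Projection

variable (φ : HilbertBasis ℕ ℝ L2I) (d : ℕ)

lemma proj_sub (a b : L2I) : proj φ d (a - b) = proj φ d a - proj φ d b := by
  simp only [proj, inner_sub_right, sub_smul, Finset.sum_sub_distrib]

lemma inner_proj_left (a b : L2I) : ⟪proj φ d a, b⟫_ℝ = ⟪proj φ d a, proj φ d b⟫_ℝ := by
  simp only [proj, sum_inner, inner_smul_left]
  refine Finset.sum_congr rfl fun j hj => ?_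
  rw [φ.orthonormal.inner_right_sum _ hj]

/-- Pythagoras, as the projection is orthogonal. -/
lemma norm_sq_sub_norm_proj_sq (a : L2I) :
    ‖a‖ ^ 2 - ‖proj φ d a‖ ^ 2 = ‖a - proj φ d a‖ ^ 2 := by
  rw [norm_sub_sq_real, real_inner_comm, inner_proj_left, real_inner_self_eq_norm_sq]
  ring

lemma norm_sub_proj_sub_le {a b : L2I} {δ : ℝ} (ha : ‖a - proj φ d a‖ ≤ δ)
    (hb : ‖b - proj φ d b‖ ≤ δ) : ‖(a - b) - proj φ d (a - b)‖ ≤ 2 * δ := by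
  rw [proj_sub, sub_sub_sub_comm]
  linarith [norm_sub_le (a - proj φ d a) (b - proj φ d b)]

end Projection

/-- If `D ≤ Δ` and `Δ² - D² ≤ ε²`, then `(Δ - D) / 4` is at most `2 ε (1 ∧ 10 ε / Δ)`. -/
lemma sub_div_four_le_marginBound {ε Δ D : ℝ} (hε : 0 < ε) (hD : 0 ≤ D) (hDΔ : D ≤ Δ)
    (h : Δ ^ 2 - D ^ 2 ≤ ε ^ 2) : (Δ - D) / 4 ≤ 2 * ε * marginBound ε Δ := by
  have h1 : Δ - D ≤ ε := by
    refine le_of_sq_le_sq ?_ hε.le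
    -- Since 0 ≤ D ≤ Δ, (Δ - D)² ≤ Δ² - D².
    nlinarith
  rw [marginBound]
  split_ifs with h0
  · linarith
  have hΔ : 0 < Δ := lt_of_le_of_ne (hD.trans hDΔ) (Ne.symm h0)
  rw [mul_min_of_nonneg _ _ (by positivity)]
  refine le_min (by linarith) ?_
  rw [mul_div_assoc', le_div_iff₀ hΔ]
  -- Here Δ(Δ - D) ≤ Δ² - D² ≤ ε².
  nlinarith

/-! ### Drifts -/

/-- The squared distance is s - 2 min(s, t) + t = |s - t|. This gives the continuity of the drift
trajectories. -/
lemma continuous_initialInd : Continuous initialInd := by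
  rw [continuous_iff_continuousAt]
  intro t
  rw [ContinuousAt, tendsto_iff_norm_sub_tendsto_zero]
  have h : ∀ s, ‖initialInd s - initialInd t‖ =
      √((s : ℝ) - 2 * ((min s t : unitInterval) : ℝ) + t) := fun s => by
    rw [← Real.sqrt_sq (norm_nonneg _), norm_sub_sq_real, inner_initialInd_initialInd,
      ← real_inner_self_eq_norm_sq, ← real_inner_self_eq_norm_sq, inner_initialInd_initialInd,
      inner_initialInd_initialInd, min_self, min_self]
  simp_rw [h]
  have hc : Continuous fun s : unitInterval =>
      √((s : ℝ) - 2 * ((min s t : unitInterval) : ℝ) + t) := by fun_prop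
  have h0 : √((t : ℝ) - 2 * ((min t t : unitInterval) : ℝ) + t) = 0 := by
    rw [min_self, Real.sqrt_eq_zero']; linarith
  have := hc.tendsto t
  rwa [h0] at this

/-- The trajectory `t ↦ ∫₀ᵗ f(s) ds`. -/
def drift (f : L2I) : Path where
  toFun t := ∫ s in Iic t, f s
  continuous_toFun := by
    simp_rw [← inner_initialInd_left]
    exact continuous_initialInd.inner continuous_const

lemma drift_apply (f : L2I) (t : unitInterval) : drift f t = ⟪initialInd t, f⟫_ℝ :=
  (inner_initialInd_left t f).symm

/-! ### Decomposition of the Wiener measure along a direction -/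

namespace IsWiener

variable {ν : Measure Path} (hν : IsWiener ν)

lemma measurable_integral (φ : L2I) : Measurable (hν.integral φ) :=
  (Lp.stronglyMeasurable _).measurable

/-- The trajectory with its component in the direction `h` removed. -/
def residual (h : L2I) (x : Path) : Path := x - hν.integral h x • drift h

lemma measurable_residual (h : L2I) : Measurable (hν.residual h) :=
  measurable_path_iff.2 fun t =>
    (measurable_path_eval t).sub ((hν.measurable_integral h).mul_const _)

/-- The residual at t is the Wiener integral of 𝟙_[0,t] - ⟪𝟙_[0,t], h⟫ h, which is orthogonal to the
unit vector h. Jointly Gaussian and uncorrelated variables are independent. -/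
lemma indepFun_integral_residual {h : L2I} (hh : ‖h‖ = 1) :
    IndepFun (hν.integral h) (hν.residual h) ν := by
  have := hν.isProbabilityMeasure
  set φ : Unit ⊕ unitInterval → L2I :=
    Sum.elim (fun _ => h) fun t => initialInd t - drift h t • h
  have hres : ∀ t : unitInterval, hν.integral (initialInd t - drift h t • h) =ᵐ[ν]
      fun x => hν.residual h x t := fun t => by
    rw [map_sub, map_smul]
    filter_upwards [Lp.coeFn_sub (hν.integral (initialInd t)) (drift h t • hν.integral h),
      Lp.coeFn_smul (drift h t) (hν.integral h), hν.integral_initialInd_ae_eq t] with x h1 h2 h3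
    rw [h1, Pi.sub_apply, h2, h3, Pi.smul_apply, smul_eq_mul, mul_comm]
    rfl
  have hres_meas : ∀ t, Measurable fun x => hν.residual h x t := fun t =>
    (measurable_path_eval t).comp (hν.measurable_residual h)
  have hG : IsGaussianProcess (Sum.elim (fun (_ : Unit) (x : Path) => hν.integral h x)
      fun (t : unitInterval) x => hν.residual h x t) ν := by
    refine (hν.isGaussianProcess_integral.comp_right φ).congr fun t => ?_
    rcases t with t | t
    · rfl
    · exact hres t
  have hmean : ∀ ψ : L2I, ∫ x, hν.integral ψ x ∂ν = 0 := fun ψ => by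
    rw [(hν.hasLaw_integral ψ).integral_eq]
    exact integral_id_gaussianReal
  have hind := hG.indepFun_of_covariance_eq_zero (fun _ => (hν.measurable_integral h).aemeasurable)
    (fun t => (hres_meas t).aemeasurable) fun _ t => by
    rw [covariance_eq_sub (Lp.memLp _) ((memLp_congr_ae (hres t)).1 (Lp.memLp _)), hmean,
      zero_mul, sub_zero]
    have : ∫ x, (hν.integral h * fun x => hν.residual h x t) x ∂ν =
        ⟪hν.integral (initialInd t - drift h t • h), hν.integral h⟫_ℝ := by
      rw [L2.inner_def]
      refine integral_congr_ae ?_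
      filter_upwards [hres t] with x hx
      simp only [Pi.mul_apply, RCLike.inner_apply, conj_trivial, hx]
    rw [this, inner_integral, inner_sub_left, inner_smul_left, real_inner_self_eq_norm_sq, hh,
      drift_apply]
    simp
  -- Independence from the family of coordinates is independence from the trajectory, because the
  -- σ-algebra on `Path` is pulled back from the product.
  rw [IndepFun_iff] at hind ⊢
  rintro _ _ ⟨A, hA, rfl⟩ ⟨_, ⟨B, hB, rfl⟩, rfl⟩
  exact hind _ _ ⟨(fun z : Unit → ℝ => z ()) ⁻¹' A, measurable_pi_apply () hA, rfl⟩ ⟨B, hB, rfl⟩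

include hν in
/-- The Neyman–Pearson bound for two shifts of the Wiener measure. -/
lemma two_mul_gaussianReal_le (f g : L2I) {A : Set Path} (hA : MeasurableSet A) :
    2 * gaussianReal 0 1 (Iic (-(‖f - g‖ / 2))) ≤
      ν ((drift f + ·) ⁻¹' A) + ν ((drift g + ·) ⁻¹' Aᶜ) := by
  have := hν.isProbabilityMeasure
  rcases eq_or_ne f g with rfl | hfg
  · have hm : Measurable fun x : Path => drift f + x :=
      measurable_path_iff.2 fun t => (measurable_path_eval t).const_add _
    rw [preimage_compl, measure_add_measure_compl (hm hA), measure_univ]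
    simp [gaussianReal_Iic_zero]
  set Δ := ‖f - g‖
  have hΔ : 0 < Δ := norm_pos_iff.2 (sub_ne_zero.2 hfg)
  set h : L2I := Δ⁻¹ • (f - g)
  have hh : ‖h‖ = 1 := by
    rw [norm_smul, norm_inv, norm_norm, inv_mul_cancel₀ hΔ.ne']
  set ρ := ν.map (hν.residual h)
  have := Measure.isProbabilityMeasure_map (μ := ν) (hν.measurable_residual h).aemeasurable
  have hlaw : ν.map (fun x => (hν.integral h x, hν.residual h x)) = (gaussianReal 0 1).prod ρ := by
    rw [(indepFun_iff_map_prod_eq_prod_map_map (hν.measurable_integral h).aemeasurable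
      (hν.measurable_residual h).aemeasurable).1 (hν.indepFun_integral_residual hh),
      (hν.hasLaw_integral h).map_eq, hh]
    simp [ρ]
  have hpair : Measurable fun x => (hν.integral h x, hν.residual h x) :=
    (hν.measurable_integral h).prodMk (hν.measurable_residual h)
  have hshift : ∀ c : ℝ, Measurable fun p : ℝ × Path => drift g + p.2 + (p.1 + c) • drift h :=
    fun c => measurable_path_iff.2 fun t =>
      (((measurable_path_eval t).comp measurable_snd).const_add _).add
        ((measurable_fst.add_const c).mul_const _)
  have hline : ∀ S : Set Path, MeasurableSet S → ∀ r : Path,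
      MeasurableSet {z : ℝ | drift g + r + z • drift h ∈ S} := fun S hS r => by
    have := measurable_prodMk_right (y := r) (hshift 0 hS)
    simp only [add_zero] at this
    exact this
  -- Fubini: at a fixed residual r, the trajectory runs along the line with direction `drift h`, its
  -- coordinate having law N(c, 1). The values c = Δ and c = 0 give the hypotheses f and g.
  have key : ∀ c : ℝ, ∀ S : Set Path, MeasurableSet S →
      ν ((fun x => drift g + hν.residual h x + (hν.integral h x + c) • drift h) ⁻¹' S) =
        ∫⁻ r, gaussianReal c 1 {z | drift g + r + z • drift h ∈ S} ∂ρ := fun c S hS => by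
    have e : (fun x => drift g + hν.residual h x + (hν.integral h x + c) • drift h) ⁻¹' S =
        (fun x => (hν.integral h x, hν.residual h x)) ⁻¹'
          ((fun p : ℝ × Path => drift g + p.2 + (p.1 + c) • drift h) ⁻¹' S) := rfl
    rw [e, ← Measure.map_apply hpair (hshift c hS), hlaw, Measure.prod_apply_symm (hshift c hS)]
    refine lintegral_congr fun r => ?_
    have hc := gaussianReal_map_add_const (μ := 0) (v := 1) c
    rw [zero_add] at hc
    rw [← hc, Measure.map_apply (measurable_add_const c) (hline S hS r)]
    rfl
  have e1 : (fun x => drift f + x) =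
      fun x => drift g + hν.residual h x + (hν.integral h x + Δ) • drift h := by
    funext x
    ext t
    have : drift f t - drift g t = Δ * drift h t := by
      simp only [drift_apply, h, ← inner_sub_right, inner_smul_right]
      field_simp
    simp only [residual, ContinuousMap.add_apply, ContinuousMap.sub_apply,
      ContinuousMap.smul_apply, smul_eq_mul]
    linarith
  have e2 : (fun x => drift g + x) =
      fun x => drift g + hν.residual h x + (hν.integral h x + 0) • drift h := by
    funext x
    simp [residual, add_assoc]
  have hmeas : ∀ S : Set Path, MeasurableSet S →
      Measurable fun r => gaussianReal Δ 1 {z | drift g + r + z • drift h ∈ S} := fun S hS => by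
    have := measurable_measure_prodMk_right (μ := gaussianReal Δ 1) (hshift 0 hS)
    simp only [add_zero] at this
    exact this
  rw [e1, e2, key Δ A hA, key 0 Aᶜ hA.compl, ← lintegral_add_left (hmeas A hA)]
  calc 2 * gaussianReal 0 1 (Iic (-(Δ / 2)))
      = ∫⁻ _, 2 * gaussianReal 0 1 (Iic (-(Δ / 2))) ∂ρ := by simp
    _ ≤ _ := lintegral_mono fun r => two_mul_gaussianReal_Iic_le hΔ.le (hline A hA r)

end IsWiener

/-! ### Risks -/

namespace IsModel

variable {Ω : Type*} [MeasurableSpace Ω] {P : Measure Ω}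
  {f g : L2I} {W X : Ω → Path} {Y : Ω → Fin 2}

lemma path_ae_eq (hX : IsModel P f g W X Y) :
    ∀ᵐ ω ∂P, X ω = (if Y ω = 1 then drift f else drift g) + W ω := by
  filter_upwards [hX.equation] with ω h
  ext t
  rw [h t]
  rcases Fin.exists_fin_two.1 ⟨Y ω, rfl⟩ with hy | hy <;> simp [hy, label, drift]

variable [IsProbabilityMeasure P]

lemma prob_label_eq_zero (hX : IsModel P f g W X Y) : P {ω | Y ω = 0} = 1 / 2 := by
  have e : {ω | Y ω = 0} = {ω | Y ω = 1}ᶜ := by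
    ext ω
    change Y ω = 0 ↔ ¬ Y ω = 1
    omega
  have hm : MeasurableSet {ω | Y ω = 1} := hX.measurable_label (measurableSet_singleton 1)
  rw [e, prob_compl_eq_one_sub hm, hX.bernoulli, one_div, ENNReal.one_sub_inv_two]

lemma measureReal_label_split (hX : IsModel P f g W X Y) {A B : Set Path}
    (hA : MeasurableSet A) (hB : MeasurableSet B) :
    P.real {ω | (Y ω = 1 ∧ W ω ∈ A) ∨ (Y ω = 0 ∧ W ω ∈ B)} =
      1 / 2 * ((P.map W).real A + (P.map W).real B) := by
  have hone : ∀ (y : Fin 2) (S : Set Path), MeasurableSet S → P {ω | Y ω = y} = 1 / 2 →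
      P.real (W ⁻¹' S ∩ Y ⁻¹' {y}) = 1 / 2 * (P.map W).real S := fun y S hS hy => by
    have hi := hX.indep.measure_inter_preimage_eq_mul S {y} hS (measurableSet_singleton y)
    change P (Y ⁻¹' {y}) = 1 / 2 at hy
    rw [measureReal_def, hi, hy, measureReal_def, Measure.map_apply hX.brownian.measurable hS]
    simp [mul_comm]
  have e : {ω | (Y ω = 1 ∧ W ω ∈ A) ∨ (Y ω = 0 ∧ W ω ∈ B)} =
      (W ⁻¹' A ∩ Y ⁻¹' {1}) ∪ (W ⁻¹' B ∩ Y ⁻¹' {0}) := by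
    ext ω
    simp [and_comm]
  have hd : Disjoint (W ⁻¹' A ∩ Y ⁻¹' {1}) (W ⁻¹' B ∩ Y ⁻¹' {0}) := by
    refine disjoint_left.2 fun ω h1 h0 => ?_
    have a : Y ω = 1 := h1.2
    have b : Y ω = 0 := h0.2
    rw [a] at b
    exact absurd b one_ne_zero
  rw [e, measureReal_union hd ((hX.brownian.measurable hB).inter
    (hX.measurable_label (measurableSet_singleton 0))), hone 1 A hA hX.bernoulli,
    hone 0 B hB hX.prob_label_eq_zero, mul_add]

/-- Every classifier has risk at least `Ψ(-Δ / 2)`, where `Ψ` is the standard normal distribution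
function. -/
lemma normalCDF_le_risk (hX : IsModel P f g W X Y) {Φ : Path → Fin 2} (hΦ : Measurable Φ) :
    normalCDF (-(‖f - g‖ / 2)) ≤ risk P X Y Φ := by
  have hν := hX.isWiener
  have := hν.isProbabilityMeasure
  have hdrift : ∀ k : L2I, Measurable fun x : Path => drift k + x := fun k =>
    measurable_path_iff.2 fun t => (measurable_path_eval t).const_add _
  set A : Set Path := Φ ⁻¹' {0}
  have hA : MeasurableSet A := hΦ (measurableSet_singleton 0)
  have e : {ω | Φ (X ω) ≠ Y ω} =ᵐ[P] {ω | (Y ω = 1 ∧ W ω ∈ (drift f + ·) ⁻¹' A) ∨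
      (Y ω = 0 ∧ W ω ∈ (drift g + ·) ⁻¹' Aᶜ)} := by
    filter_upwards [hX.path_ae_eq] with ω hω
    refine propext ?_
    change Φ (X ω) ≠ Y ω ↔ (Y ω = 1 ∧ Φ (drift f + W ω) = 0) ∨ (Y ω = 0 ∧ ¬ Φ (drift g + W ω) = 0)
    rw [hω]
    by_cases hy : Y ω = 1
    · rw [if_pos hy, hy]
      simp only [true_and, one_ne_zero, false_and, or_false, ne_eq, Fin.isValue]
      omega
    · have hy0 : Y ω = 0 := by omega
      rw [if_neg hy, hy0]
      simp
  rw [risk, measureReal_congr e,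
    hX.measureReal_label_split (hdrift f hA) (hdrift g hA.compl)]
  have h := ENNReal.toReal_mono (by finiteness) (hν.two_mul_gaussianReal_le f g hA)
  rw [ENNReal.toReal_mul, ENNReal.toReal_add (by finiteness) (by finiteness)] at h
  simp only [normalCDF, measureReal_def]
  simp only [ENNReal.toReal_ofNat] at h
  linarith

/-- The risk of the truncated oracle classifier. -/
lemma risk_bayesTrunc (hX : IsModel P f g W X Y) (φ : HilbertBasis ℕ ℝ L2I) (d : ℕ) :
    risk P X Y (bayesTrunc P X φ d f g) =
      normalCDF (-(‖proj φ d f - proj φ d g‖ / 2)) := by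
  have hν := hX.isWiener
  have := hν.isProbabilityMeasure
  set u := proj φ d f - proj φ d g
  set D := ‖u‖
  have hu : proj φ d (f - g) = u := proj_sub φ d f g
  have inner_u : ∀ k : L2I, ⟪u, k⟫_ℝ = ⟪u, proj φ d k⟫_ℝ := fun k => by
    rw [← hu, inner_proj_left]
  have hD2 : D ^ 2 = ‖proj φ d f‖ ^ 2 - 2 * ⟪proj φ d f, proj φ d g⟫_ℝ + ‖proj φ d g‖ ^ 2 :=
    norm_sub_sq_real _ _
  -- The norm terms in the log-ratio centre it at D²/2 when Y = 1 and, below, at -D²/2 when Y = 0.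
  have inner_f : ⟪u, f⟫_ℝ - 1 / 2 * ‖proj φ d f‖ ^ 2 + 1 / 2 * ‖proj φ d g‖ ^ 2 = D ^ 2 / 2 := by
    rw [inner_u, inner_sub_left, real_inner_self_eq_norm_sq, hD2,
      real_inner_comm (proj φ d f) (proj φ d g)]
    ring
  have inner_g : ⟪u, g⟫_ℝ - 1 / 2 * ‖proj φ d f‖ ^ 2 + 1 / 2 * ‖proj φ d g‖ ^ 2 =
      -(D ^ 2 / 2) := by
    rw [inner_u, inner_sub_left, real_inner_self_eq_norm_sq, hD2]
    ring
  have heta : ∀ l : ℝ, 1 / 2 ≤ Real.exp l / (1 + Real.exp l) ↔ 0 ≤ l := fun l => by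
    rw [div_le_div_iff₀ two_pos (by positivity), ← Real.one_le_exp_iff]
    constructor <;> intro h <;> linarith
  set A : Set Path := hν.integral u ⁻¹' Iio (-(D ^ 2 / 2))
  set B : Set Path := hν.integral u ⁻¹' Ici (D ^ 2 / 2)
  have hA : MeasurableSet A := hν.measurable_integral u measurableSet_Iio
  have hB : MeasurableSet B := hν.measurable_integral u measurableSet_Ici
  have e : {ω | bayesTrunc P X φ d f g (X ω) ≠ Y ω} =ᵐ[P]
      {ω | (Y ω = 1 ∧ W ω ∈ A) ∨ (Y ω = 0 ∧ W ω ∈ B)} := by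
    filter_upwards [hX.stochIntegral_ae_eq u] with ω hω
    refine propext ?_
    change (if 1 / 2 ≤ etaTrunc P X φ d f g (X ω) then (1 : Fin 2) else 0) ≠ Y ω ↔
      (Y ω = 1 ∧ hν.integral u (W ω) < -(D ^ 2 / 2)) ∨
        (Y ω = 0 ∧ D ^ 2 / 2 ≤ hν.integral u (W ω))
    have hL : 1 / 2 ≤ etaTrunc P X φ d f g (X ω) ↔
        0 ≤ label (Y ω) * ⟪u, f⟫_ℝ + (1 - label (Y ω)) * ⟪u, g⟫_ℝ + hν.integral u (W ω) -
          1 / 2 * ‖proj φ d f‖ ^ 2 + 1 / 2 * ‖proj φ d g‖ ^ 2 := by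
      rw [etaTrunc, heta, logRatio, hω]
    rw [if_congr hL rfl rfl]
    rcases Fin.exists_fin_two.1 ⟨Y ω, rfl⟩ with hy | hy
    · have : (0 ≤ label 0 * ⟪u, f⟫_ℝ + (1 - label 0) * ⟪u, g⟫_ℝ + hν.integral u (W ω) -
          1 / 2 * ‖proj φ d f‖ ^ 2 + 1 / 2 * ‖proj φ d g‖ ^ 2) ↔
          D ^ 2 / 2 ≤ hν.integral u (W ω) := by
        simp only [label, Fin.val_zero, Nat.cast_zero]
        constructor <;> intro h <;> linarith
      rw [hy, if_congr this rfl rfl]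
      split_ifs with h <;> simp [h]
    · have : (0 ≤ label 1 * ⟪u, f⟫_ℝ + (1 - label 1) * ⟪u, g⟫_ℝ + hν.integral u (W ω) -
          1 / 2 * ‖proj φ d f‖ ^ 2 + 1 / 2 * ‖proj φ d g‖ ^ 2) ↔
          ¬ hν.integral u (W ω) < -(D ^ 2 / 2) := by
        simp only [label, Fin.val_one, Nat.cast_one, not_lt]
        constructor <;> intro h <;> linarith
      rw [hy, if_congr this rfl rfl]
      split_ifs with h <;> simp [h]
  rw [risk, measureReal_congr e, hX.measureReal_label_split hA hB]
  have h := congrArg ENNReal.toReal (gaussianReal_sq_Iio_add_Ici (norm_nonneg u))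
  rw [ENNReal.toReal_mul, ENNReal.toReal_add (by finiteness) (by finiteness),
    ← (hν.hasLaw_integral u).map_eq, Measure.map_apply (hν.measurable_integral u) measurableSet_Iio,
    Measure.map_apply (hν.measurable_integral u) measurableSet_Ici, ENNReal.toReal_ofNat] at h
  simp only [normalCDF, measureReal_def]
  linarith

end IsModel

/-- Measurability is all that the universal lower bound requires of the Bayes classifier. -/
lemma measurable_bayes {Ω : Type*} [MeasurableSpace Ω] (P : Measure Ω) [IsProbabilityMeasure P]
    (X : Ω → Path) (Y : Ω → Fin 2) : Measurable (bayes P X Y) := by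
  have h : Measurable (eta P X Y) :=
    ((condDistrib Y X P).measurable_coe (measurableSet_singleton 1)).ennreal_toReal
  exact Measurable.ite (measurableSet_le measurable_const h) measurable_const measurable_const

end WhiteNoise

end

/-! ### The excess risk bound -/

theorem lemma1 {Ω : Type*} [MeasurableSpace Ω] (P : Measure Ω) [IsProbabilityMeasure P]
    (f g : WhiteNoise.L2I) (W X : Ω → WhiteNoise.Path) (Y : Ω → Fin 2)
    (hX : WhiteNoise.IsModel P f g W X Y)
    (φ : HilbertBasis ℕ ℝ WhiteNoise.L2I) (d : ℕ) (hd : 1 ≤ d)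
    (ε : ℝ) (hε : 0 < ε) (hε' : ε ≤ 1 / 8)
    (hproj : max (‖f - WhiteNoise.proj φ d f‖ ^ 2) (‖g - WhiteNoise.proj φ d g‖ ^ 2) ≤
      ε ^ 2 / (512 * Real.log (1 / ε ^ 2))) :
    WhiteNoise.risk P X Y (WhiteNoise.bayesTrunc P X φ d f g) -
        WhiteNoise.risk P X Y (WhiteNoise.bayes P X Y) ≤
      12 * ε ^ 2 + 2 * ε * WhiteNoise.marginBound ε ‖f - g‖ := by
  open WhiteNoise in
  -- As ε ≤ 1/8, 1/ε² ≥ 64 > e. With the logarithm at least 1, the hypothesis leaves ample room for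
  -- a tail of norm at most ε/2 for each of f and g, hence ε for f - g.
  have hlog : 1 ≤ Real.log (1 / ε ^ 2) := by
    rw [Real.le_log_iff_exp_le (by positivity), le_div_iff₀ (by positivity)]
    nlinarith [Real.exp_one_lt_d9, Real.exp_pos 1]
  have hK : ε ^ 2 / (512 * Real.log (1 / ε ^ 2)) ≤ (ε / 2) ^ 2 := by
    rw [div_le_iff₀ (by positivity)]
    nlinarith [sq_nonneg ε]
  have hf : ‖f - proj φ d f‖ ≤ ε / 2 :=
    le_of_sq_le_sq (((le_max_left _ _).trans hproj).trans hK) (by positivity)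
  have hg : ‖g - proj φ d g‖ ≤ ε / 2 :=
    le_of_sq_le_sq (((le_max_right _ _).trans hproj).trans hK) (by positivity)
  have hpyth := norm_sq_sub_norm_proj_sq φ d (f - g)
  have hsub := norm_sub_proj_sub_le φ d hf hg
  have hDΔ : ‖proj φ d f - proj φ d g‖ ≤ ‖f - g‖ := by
    rw [← proj_sub]
    refine le_of_sq_le_sq ?_ (norm_nonneg _)
    nlinarith [sq_nonneg ‖(f - g) - proj φ d (f - g)‖]
  have hsq : ‖f - g‖ ^ 2 - ‖proj φ d f - proj φ d g‖ ^ 2 ≤ ε ^ 2 := by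
    rw [← proj_sub, hpyth]
    exact pow_le_pow_left₀ (norm_nonneg _) (hsub.trans_eq (by ring)) 2
  have hbound := sub_div_four_le_marginBound hε (norm_nonneg _) hDΔ hsq
  have hcdf := normalCDF_sub_le (a := -(‖f - g‖ / 2)) (b := -(‖proj φ d f - proj φ d g‖ / 2))
    (by linarith)
  have hbayes := hX.normalCDF_le_risk (measurable_bayes P X Y)
  rw [hX.risk_bayesTrunc φ d]
  -- The margin term already dominates (Δ - D)/4; 12 ε² is slack.
  nlinarith [sq_nonneg ε]
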